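/- Let $\mu,\nu$ be Borel probability measures on $[0,1]$ with $\mu$ atomless, $\operatorname{supp}(\nu)\subseteq\operatorname{supp}(\mu)$ and $\nu(\{0,1\})=0$. Let $F_\mu(x)=\mu([0,x])$, let $\check F_\mu^{-1}(x)=\inf\{y\in[0,1]:F_\mu(y)\ge x\}$, let $\Lambda$ be Lebesgue measure on $[0,1]$, and let $\nu\circ F_\mu^{-1}$ be the image of $\nu$ under $F_\mu$. The weak generalised Kreĭn–Feller operator $\Delta_{\nu,\mu}$ is defined as follows: a continuous function $f:[0,1]\to\mathbb R$ lies in $\mathcal D^w(\Delta_{\nu,\mu})$ and $\Delta_{\nu,\mu}f=g\in L^2(\nu)$ if there are $a,b\in\mathbb R$ with $$f(x)=a+bF_\mu(x)+\int_{[0,x]}(F_\mu(x)-F_\mu(y))\,g(y)\,d\nu(y)\qquad(x\in[0,1]).$$ Put $\nabla_\mu f(0)=\lim_{x\downarrow \inf\operatorname{supp}(\mu)}\frac{f(x)-f(0)}{F_\mu(x)-F_\mu(0)}$ and $\nabla_\mu f(1)=\nabla_\mu f(0)+\int_{[0,1]}\Delta_{\nu,\mu}f\,d\nu$. For $\gamma=(\alpha,\beta)\in[0,\pi/2]^2$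 let $\mathcal D^w_\gamma(\Delta_{\nu,\mu})$ be the set of $f\in\mathcal D^w(\Delta_{\nu,\mu})$ satisfying the Robin boundary conditions $$f(0)\cos\alpha-\nabla_\mu f(0)\sin\alpha=0,\qquad f(1)\cos\beta+\nabla_\mu f(1)\sin\beta=0.$$ An eigenfunction with eigenvalue $\lambda\in\mathbb R$ is an $f\in\mathcal D^w_\gamma(\Delta_{\nu,\mu})$, not $\nu$-almost everywhere zero, with $\Delta_{\nu,\mu}f=\lambda f$ (that is, all of the above holds with $g=\lambda f$). The operator $\Delta_{\nu\circ F_\mu^{-1},\Lambda}$ is defined in the same way from the measures $\nu\circ F_\mu^{-1}$ and $\Lambda$. Fix $\gamma\in[0,\pi/2]^2$. Then: 1. $\Delta_{\nu\circ F_\mu^{-1},\Lambda}$ with domain $\mathcal D^w_\gamma(\Delta_{\nu\circ F_\mu^{-1},\Lambda})$ and $\Delta_{\nu,\mu}$ with domain $\mathcal D^w_\gamma(\Delta_{\nu,\mu})$ have the same eigenvalues. 2. If $f$ is an eigenfunction of $\Delta_{\nu,\mu}$ with eigenvalue $\lambda$, then $f\circ\check F_\mu^{-1}$ is an eigenfunction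 of $\Delta_{\nu\circ F_\mu^{-1},\Lambda}$ with eigenvalue $\lambda$, and $f\circ\check F_\mu^{-1}\circ F_\mu=f$. If $f$ is an eigenfunction of $\Delta_{\nu\circ F_\mu^{-1},\Lambda}$ with eigenvalue $\lambda$, then $f\circ F_\mu$ is an eigenfunction of $\Delta_{\nu,\mu}$ with eigenvalue $\lambda$, and $f\circ F_\mu\circ\check F_\mu^{-1}=f$. 3. Suppose in addition that $F_\mu(x)\neq F_\mu(y)$ for any two distinct atoms $x,y$ of $\nu$ (for instance, $\nu$ atomless). If $(f_n)$ is a (finite or infinite) orthonormal basis of $L^2(\nu\circ F_\mu^{-1})$ consisting of eigenfunctions of $\Delta_{\nu\circ F_\mu^{-1},\Lambda}$ with eigenvalues $(\lambda_n)$, then $(f_n\circ F_\mu)$ is an orthonormal basis of $L^2(\nu)$ consisting of eigenfunctions of $\Delta_{\nu,\mu}$ with the same eigenvalues $(\lambda_n)$. -/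

import Mathlib

open MeasureTheory Filter Topology Set
open scoped unitInterval

noncomputable section

namespace KreinFeller

/-- The distribution function `F_μ : [0,1] → [0,1]`, `F_μ(x) = μ([0,x])`, of a Borel probability
measure on `[0,1]`. -/
def distFun (μ : Measure I) [IsProbabilityMeasure μ] (x : I) : I :=
  ⟨μ.real (Iic x), measureReal_nonneg, measureReal_le_one⟩

theorem monotone_distFun (μ : Measure I) [IsProbabilityMeasure μ] : Monotone (distFun μ) :=
  fun _ _ h => Subtype.mk_le_mk.2 (measureReal_mono (Iic_subset_Iic.2 h))

/-- In particular the push-forward `ν.map (distFun μ)` is the genuine image measure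
`A ↦ ν (F_μ ⁻¹ A)`. -/
theorem measurable_distFun (μ : Measure I) [IsProbabilityMeasure μ] : Measurable (distFun μ) :=
  (monotone_distFun μ).measurable

/-- The pseudo-inverse `x ↦ inf {y ∈ [0,1] : F_μ(y) ≥ x}` of `F_μ`. The infimum is taken in `[0,1]`,
over a set that contains `1`. -/
def pseudoInv (μ : Measure I) [IsProbabilityMeasure μ] (x : I) : I :=
  sInf {y : I | x ≤ distFun μ y}

/-- `IsKreinFeller ν μ f g` says that `f ∈ D^w(Δ_{ν,μ})` and `Δ_{ν,μ} f = g` in `L²(ν)`: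
this is the graph of the weak generalised Krein-Feller operator. Functions `g` that agree
`ν`-almost everywhere represent the same element of `L²(ν)` and are interchangeable here. -/
structure IsKreinFeller (ν μ : Measure I) [IsProbabilityMeasure μ] (f g : I → ℝ) : Prop where
  continuous : Continuous f
  memLp : MemLp g 2 ν
  exists_repr : ∃ a b : ℝ, ∀ x : I,
    f x = a + b * (distFun μ x : ℝ) +
      ∫ y in Iic x, ((distFun μ x : ℝ) - (distFun μ y : ℝ)) * g y ∂ν

/-- `d = ∇_μ f(0)`: the limit of `(f(x) - f(0)) / (F_μ(x) - F_μ(0))` as `x` decreases to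
`inf (supp μ)` exists and equals `d`. -/
def HasInitialDeriv (μ : Measure I) [IsProbabilityMeasure μ] (f : I → ℝ) (d : ℝ) : Prop :=
  Tendsto (fun x : I => (f x - f 0) / ((distFun μ x : ℝ) - (distFun μ 0 : ℝ)))
    (𝓝[>] (sInf μ.support)) (𝓝 d)

/-- The Robin boundary conditions with parameters `(α, β)` for a function `f` with
`Δ_{ν,μ} f = g`. Here `d = ∇_μ f(0)`, and
`d + ∫_{[0,1]} g dν = ∇_μ f(0) + ∫_{[0,1]} Δ_{ν,μ} f dν = ∇_μ f(1)`. -/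
def RobinCondition (ν μ : Measure I) [IsProbabilityMeasure μ] (α β : ℝ) (f g : I → ℝ) : Prop :=
  ∃ d : ℝ, HasInitialDeriv μ f d ∧
    f 0 * Real.cos α - d * Real.sin α = 0 ∧
    f 1 * Real.cos β + (d + ∫ y, g y ∂ν) * Real.sin β = 0

/-- `f` is an eigenfunction, with eigenvalue `lam`, of `Δ_{ν,μ}` with domain
`D^w_γ(Δ_{ν,μ})`, `γ = (α, β)`: it lies in the domain, `Δ_{ν,μ} f = lam f` in `L²(ν)`, and `f` is
not the zero element of `L²(ν)`. -/
structure IsEigenfunction (ν μ : Measure I) [IsProbabilityMeasure μ] (α β lam : ℝ)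
    (f : I → ℝ) : Prop where
  apply_eq : IsKreinFeller ν μ f (fun x => lam * f x)
  boundary : RobinCondition ν μ α β f (fun x => lam * f x)
  ne_zero : ¬ f =ᵐ[ν] 0

/-- The eigenvalues of `Δ_{ν,μ}` with domain `D^w_γ(Δ_{ν,μ})`, `γ = (α, β)`. -/
def eigenvalues (ν μ : Measure I) [IsProbabilityMeasure μ] (α β : ℝ) : Set ℝ :=
  {lam | ∃ f : I → ℝ, IsEigenfunction ν μ α β lam f}

/-- The functions `f i` are (representatives of) an orthonormal basis of the Hilbert space
`L²(ν)`. -/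
def IsOrthonormalBasis {ι : Type*} (ν : Measure I) (f : ι → I → ℝ) : Prop :=
  ∃ B : HilbertBasis ι ℝ (Lp ℝ 2 ν), ∀ i, (B i : I → ℝ) =ᵐ[ν] f i

end KreinFeller

end

/-!
Write `F = F_μ`. Since `μ` has no atoms, `F` is a continuous surjection of `[0,1]`, and its
pseudo-inverse is a right inverse of it. For `y ≤ x` the kernel `F x - F y` equals
`max (F x - F y) 0`, and for `y > x` this maximum vanishes, so that

`∫_{[0,x]} (F x - F y) g y dν(y) = ∫ max (F x - F y) 0 * g y dν(y)`

depends on `x` only through `F x`. Hence every `f` in the domain of `Δ_{ν,μ}` factors as `h ∘ F`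
with `h = f ∘ F⁻¹`, and the change of variables `s = F y` turns the equation for `f` into the
equation for `h` with respect to `ν ∘ F⁻¹` and Lebesgue measure, whose distribution function is the
identity (`isKreinFeller_comp_iff`). Continuity of `f` passes to `h` because `F` is a quotient map,
and the boundary conditions agree because `F` maps the filter of right neighbourhoods of
`inf (supp μ)` to that of `0` (`map_distFun_nhdsGT`). So `h` is an eigenfunction exactly when
`h ∘ F` is one (`isEigenfunction_comp_iff`), which gives the correspondence of eigenfunctions and
the equality of the eigenvalues.

For the orthonormal bases, composition with `F` is a linear isometry of `L²(ν ∘ F⁻¹)` into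
`L²(ν)`, and it has to be shown to be onto. The support of `ν` lies in that of `μ`, which meets a
level interval of `F` at most in its two end points; only countably many level intervals are
nondegenerate, and each contains at most one atom of `ν`. Choosing in each of them that atom, or the
lower end point if there is none, gives a measurable left inverse of `F` off a `ν`-null set
(`exists_measurable_ae_leftInverse`).
-/

namespace KreinFeller

variable {μ ν : Measure I} [IsProbabilityMeasure μ]

/-! ### The distribution function and its pseudo-inverse -/

theorem distFun_volume (x : I) : distFun (volume : Measure I) x = x := by
  apply Subtype.ext
  change (volume : Measure I).real (Iic x) = x
  rw [Measure.real, unitInterval.volume_Iic, ENNReal.toReal_ofReal x.2.1]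

theorem continuous_distFun (μ : Measure I) [IsProbabilityMeasure μ] [NullSingletonClass μ] :
    Continuous (distFun μ) := by
  refine Continuous.subtype_mk ?_ _
  have h : ∀ x : I, μ.real (Iic x) = ∫ y, (Iic x).indicator (fun _ => (1 : ℝ)) y ∂μ := fun x => by
    rw [integral_indicator measurableSet_Iic]; simp
  simp_rw [h]
  refine continuous_iff_continuousAt.2 fun x₀ => ?_
  refine continuousAt_of_dominated (bound := fun _ => 1) ?_ ?_ (integrable_const _) ?_
  · exact Eventually.of_forall fun x =>
      (measurable_const.indicator measurableSet_Iic).aestronglyMeasurable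
  · refine Eventually.of_forall fun x => Eventually.of_forall fun y => ?_
    by_cases hy : y ∈ Iic x <;> simp [hy]
  · filter_upwards [compl_mem_ae_iff.2 (measure_singleton (μ := μ) x₀)] with y hy
    -- Away from `y` the function `x ↦ 1_{y ≤ x}` is locally constant.
    rcases lt_or_gt_of_ne (show y ≠ x₀ from hy) with h | h
    · refine (continuousAt_const (y := (1 : ℝ))).congr ?_
      filter_upwards [lt_mem_nhds h] with x hx
      simp [hx.le]
    · refine (continuousAt_const (y := (0 : ℝ))).congr ?_
      filter_upwards [gt_mem_nhds h] with x hx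
      simp [hx]

theorem distFun_zero [NullSingletonClass μ] : distFun μ 0 = 0 := by
  apply Subtype.ext
  change μ.real (Iic 0) = 0
  have : Iic (0 : I) = {0} := by
    ext x; exact le_antisymm_iff.trans (and_iff_left unitInterval.nonneg') |>.symm
  rw [this, Measure.real, measure_singleton, ENNReal.toReal_zero]

theorem distFun_one : distFun μ 1 = 1 := by
  apply Subtype.ext
  change μ.real (Iic 1) = 1
  have : Iic (1 : I) = univ := by
    ext x; simpa using unitInterval.le_one'
  simp [this]

theorem distFun_surjective [NullSingletonClass μ] : Function.Surjective (distFun μ) := by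
  intro t
  have h := intermediate_value_univ (0 : I) 1 (continuous_distFun μ)
  rw [distFun_zero, distFun_one] at h
  exact h ⟨unitInterval.nonneg', unitInterval.le_one'⟩

theorem pseudoInv_le {t x : I} (h : t ≤ distFun μ x) : pseudoInv μ t ≤ x :=
  sInf_le h

theorem monotone_pseudoInv (μ : Measure I) [IsProbabilityMeasure μ] : Monotone (pseudoInv μ) :=
  fun _ _ h => sInf_le_sInf fun _ hy => h.trans hy

theorem distFun_pseudoInv [NullSingletonClass μ] (t : I) : distFun μ (pseudoInv μ t) = t := by
  obtain ⟨x, hx⟩ := distFun_surjective (μ := μ) t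
  refine le_antisymm ?_ ?_
  · exact (monotone_distFun μ (pseudoInv_le hx.ge)).trans hx.le
  · have hc : IsClosed {y : I | t ≤ distFun μ y} :=
      isClosed_le continuous_const (continuous_distFun μ)
    exact hc.sInf_mem ⟨x, hx.ge⟩

/-- The upper pseudo-inverse `t ↦ sup {y ∈ [0,1] : F_μ(y) ≤ t}`. When `F_μ` is a continuous
surjection, the level set of `F_μ` at `t` is the interval from `pseudoInv μ t` to
`upperInv μ t`. -/
noncomputable def upperInv (μ : Measure I) [IsProbabilityMeasure μ] (t : I) : I :=
  sSup {y : I | distFun μ y ≤ t}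

theorem le_upperInv {t x : I} (h : distFun μ x ≤ t) : x ≤ upperInv μ t :=
  le_sSup h

theorem monotone_upperInv (μ : Measure I) [IsProbabilityMeasure μ] : Monotone (upperInv μ) :=
  fun _ _ h => sSup_le_sSup fun _ hy => hy.trans h

theorem distFun_upperInv [NullSingletonClass μ] (t : I) : distFun μ (upperInv μ t) = t := by
  obtain ⟨x, hx⟩ := distFun_surjective (μ := μ) t
  refine le_antisymm ?_ ?_
  · have hc : IsClosed {y : I | distFun μ y ≤ t} :=
      isClosed_le (continuous_distFun μ) continuous_const
    exact hc.sSup_mem ⟨x, hx.le⟩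
  · exact hx.ge.trans (monotone_distFun μ (le_upperInv hx.le))

theorem upperInv_le_pseudoInv [NullSingletonClass μ] {s t : I} (h : s < t) :
    upperInv μ s ≤ pseudoInv μ t := by
  by_contra! hlt
  have := monotone_distFun μ hlt.le
  rw [distFun_pseudoInv, distFun_upperInv] at this
  exact absurd h this.not_gt

/-- Only countably many level sets of `F_μ` are nondegenerate, because these are the jumps of the
monotone function `pseudoInv μ`. -/
theorem countable_pseudoInv_lt_upperInv (μ : Measure I) [IsProbabilityMeasure μ]
    [NullSingletonClass μ] : {t : I | pseudoInv μ t < upperInv μ t}.Countable := by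
  refine (countable_image_lt_image_Ioi (pseudoInv μ)).mono fun t ht => ?_
  exact ⟨upperInv μ t, ht, fun _ hy => upperInv_le_pseudoInv hy⟩

theorem measure_Ioo_eq_zero_of_distFun_eq {a b : I} (h : distFun μ a = distFun μ b) :
    μ (Ioo a b) = 0 := by
  rcases lt_or_ge a b with hab | hab
  · have h' : μ.real (Iic a) = μ.real (Iic b) := congrArg (fun z : I => (z : ℝ)) h
    have h2 : μ.real (Iic b \ Iic a) = 0 := by
      rw [measureReal_sdiff (Iic_subset_Iic.2 hab.le) measurableSet_Iic, h', sub_self]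
    refine measure_mono_null (fun y hy => ?_) ((measureReal_eq_zero_iff).1 h2)
    exact ⟨hy.2.le, not_le.2 hy.1⟩
  · simp [Ioo_eq_empty hab.not_gt]

theorem distFun_sInf_support [NullSingletonClass μ] : distFun μ (sInf μ.support) = 0 := by
  apply Subtype.ext
  change μ.real (Iic (sInf μ.support)) = 0
  rw [measureReal_eq_zero_iff, ← Iio_union_right, measure_union_null_iff]
  refine ⟨measure_mono_null (fun y hy => ?_) (Measure.measure_compl_support (μ := μ)),
    measure_singleton _⟩
  exact fun hy' => (not_le.2 hy) (sInf_le hy')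

theorem distFun_pos_of_sInf_support_lt {x : I} (hx : sInf μ.support < x) : 0 < distFun μ x := by
  obtain ⟨p, hp, hpx⟩ := sInf_lt_iff.1 hx
  have h1 : 0 < μ (Iic x) := (Measure.mem_support_iff_forall p).1 hp _ (Iic_mem_nhds hpx)
  exact ENNReal.toReal_pos h1.ne' (measure_ne_top _ _)

theorem map_distFun_nhdsGT (μ : Measure I) [IsProbabilityMeasure μ] [NullSingletonClass μ] :
    map (distFun μ) (𝓝[>] (sInf μ.support)) = 𝓝[>] 0 := by
  refine le_antisymm ?_ ?_
  · refine tendsto_nhdsWithin_iff.2 ⟨?_, ?_⟩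
    · have h := (continuous_distFun μ).tendsto (sInf μ.support)
      rw [distFun_sInf_support] at h
      exact h.mono_left nhdsWithin_le_nhds
    · filter_upwards [self_mem_nhdsWithin] with x hx
      exact distFun_pos_of_sInf_support_lt hx
  · have hgt : ∀ t : I, 0 < t → sInf μ.support < pseudoInv μ t := fun t ht => by
      by_contra! hle
      have := monotone_distFun μ hle
      rw [distFun_pseudoInv, distFun_sInf_support] at this
      exact absurd ht this.not_gt
    have hG : Tendsto (pseudoInv μ) (𝓝[>] 0) (𝓝[>] (sInf μ.support)) := by
      refine tendsto_nhdsWithin_iff.2 ⟨tendsto_order.2 ⟨fun a ha => ?_, fun a ha => ?_⟩, ?_⟩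
      · filter_upwards [self_mem_nhdsWithin] with t ht using ha.trans (hgt t ht)
      · obtain ⟨x, hcx, hxa⟩ := exists_between ha
        filter_upwards [mem_nhdsWithin_of_mem_nhds
          (gt_mem_nhds (distFun_pos_of_sInf_support_lt hcx))] with t ht
        exact (pseudoInv_le (le_of_lt ht)).trans_lt hxa
      · filter_upwards [self_mem_nhdsWithin] with t ht using hgt t ht
    have := map_mono (m := distFun μ) hG
    rwa [map_map, show distFun μ ∘ pseudoInv μ = id from funext distFun_pseudoInv,
      map_id] at this

/-! ### Transfer of the operator and of the eigenfunctions -/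

/-- The integral in the definition of the Krein-Feller operator depends on `x` only through
`F_μ(x)`. -/
theorem setIntegral_Iic_distFun_sub (x : I) (g : I → ℝ) :
    ∫ y in Iic x, ((distFun μ x : ℝ) - distFun μ y) * g y ∂ν =
      ∫ y, max ((distFun μ x : ℝ) - distFun μ y) 0 * g y ∂ν := by
  rw [← integral_indicator measurableSet_Iic]
  congr 1 with y
  by_cases hy : y ≤ x
  · have h : (distFun μ y : ℝ) ≤ distFun μ x := monotone_distFun μ hy
    rw [indicator_of_mem (show y ∈ Iic x from hy), max_eq_left (sub_nonneg.2 h)]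
  · have h : (distFun μ x : ℝ) ≤ distFun μ y := monotone_distFun μ (not_le.1 hy).le
    rw [indicator_of_notMem (show y ∉ Iic x from hy), max_eq_right (sub_nonpos.2 h), zero_mul]

theorem IsKreinFeller.eq_of_distFun_eq {f g : I → ℝ} (hf : IsKreinFeller ν μ f g) {x y : I}
    (h : distFun μ x = distFun μ y) : f x = f y := by
  obtain ⟨a, b, hab⟩ := hf.exists_repr
  rw [hab, hab, setIntegral_Iic_distFun_sub, setIntegral_Iic_distFun_sub, h]

theorem continuous_comp_distFun_iff [NullSingletonClass μ] {h : I → ℝ} :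
    Continuous (h ∘ distFun μ) ↔ Continuous h :=
  ((continuous_distFun μ).isClosedMap.isQuotientMap (continuous_distFun μ)
    distFun_surjective).continuous_iff.symm

theorem isKreinFeller_comp_iff [NullSingletonClass μ] {h g : I → ℝ} (hg : Measurable g) :
    IsKreinFeller ν μ (h ∘ distFun μ) (g ∘ distFun μ) ↔
      IsKreinFeller (ν.map (distFun μ)) volume h g := by
  have hF := measurable_distFun μ
  have hmem : MemLp (g ∘ distFun μ) 2 ν ↔ MemLp g 2 (ν.map (distFun μ)) :=
    (memLp_map_measure_iff hg.aestronglyMeasurable hF.aemeasurable).symm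
  have hint : ∀ t : I, ∫ y, max ((t : ℝ) - distFun μ y) 0 * (g ∘ distFun μ) y ∂ν =
      ∫ s, max ((t : ℝ) - s) 0 * g s ∂(ν.map (distFun μ)) := fun t => by
    rw [integral_map hF.aemeasurable]
    · rfl
    · exact Measurable.aestronglyMeasurable (by fun_prop)
  have hrepr : ∀ a b : ℝ, (∀ x : I, (h ∘ distFun μ) x = a + b * (distFun μ x : ℝ) +
        ∫ y in Iic x, ((distFun μ x : ℝ) - (distFun μ y : ℝ)) * (g ∘ distFun μ) y ∂ν) ↔
      ∀ t : I, h t = a + b * (distFun (volume : Measure I) t : ℝ) +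
        ∫ s in Iic t, ((distFun (volume : Measure I) t : ℝ) -
          (distFun (volume : Measure I) s : ℝ)) * g s ∂(ν.map (distFun μ)) := fun a b => by
    refine Iff.trans (forall_congr' fun x => ?_) (distFun_surjective (μ := μ)).forall.symm
    rw [setIntegral_Iic_distFun_sub, setIntegral_Iic_distFun_sub, hint]
    simp only [distFun_volume, Function.comp_apply]
  constructor
  · rintro ⟨hc, hm, a, b, hab⟩
    exact ⟨continuous_comp_distFun_iff.1 hc, hmem.1 hm, a, b, (hrepr a b).1 hab⟩
  · rintro ⟨hc, hm, a, b, hab⟩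
    exact ⟨continuous_comp_distFun_iff.2 hc, hmem.2 hm, a, b, (hrepr a b).2 hab⟩

theorem hasInitialDeriv_iff [NullSingletonClass μ] {h : I → ℝ} {d : ℝ} :
    HasInitialDeriv μ (h ∘ distFun μ) d ↔
      Tendsto (fun t : I => (h t - h 0) / (t : ℝ)) (𝓝[>] 0) (𝓝 d) := by
  rw [← map_distFun_nhdsGT μ, tendsto_map'_iff, HasInitialDeriv]
  simp [distFun_zero, Function.comp_def]

theorem hasInitialDeriv_comp_iff [NullSingletonClass μ] {h : I → ℝ} {d : ℝ} :
    HasInitialDeriv μ (h ∘ distFun μ) d ↔ HasInitialDeriv (volume : Measure I) h d := by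
  rw [hasInitialDeriv_iff, ← hasInitialDeriv_iff (μ := volume),
    show h ∘ distFun (volume : Measure I) = h from funext fun x => congrArg h (distFun_volume x)]

theorem robinCondition_comp_iff [NullSingletonClass μ] {h g : I → ℝ} {α β : ℝ}
    (hg : Measurable g) :
    RobinCondition ν μ α β (h ∘ distFun μ) (g ∘ distFun μ) ↔
      RobinCondition (ν.map (distFun μ)) volume α β h g := by
  have hint : ∫ y, (g ∘ distFun μ) y ∂ν = ∫ s, g s ∂(ν.map (distFun μ)) :=
    (integral_map (measurable_distFun μ).aemeasurable hg.aestronglyMeasurable).symm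
  simp only [RobinCondition, hasInitialDeriv_comp_iff, ← hint, Function.comp_apply, distFun_zero,
    distFun_one]

theorem isEigenfunction_comp_iff [NullSingletonClass μ] {h : I → ℝ} {α β lam : ℝ} :
    IsEigenfunction ν μ α β lam (h ∘ distFun μ) ↔
      IsEigenfunction (ν.map (distFun μ)) volume α β lam h := by
  have key : Continuous h → (IsEigenfunction ν μ α β lam (h ∘ distFun μ) ↔
      IsEigenfunction (ν.map (distFun μ)) volume α β lam h) := fun hc => by
    have hg : Measurable fun x => lam * h x := hc.measurable.const_mul lam
    have hKF := isKreinFeller_comp_iff (μ := μ) (ν := ν) (h := h) hg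
    have hR := robinCondition_comp_iff (μ := μ) (ν := ν) (h := h) (α := α) (β := β) hg
    have hz : h ∘ distFun μ =ᵐ[ν] 0 ↔ h =ᵐ[ν.map (distFun μ)] 0 :=
      (ae_map_iff (measurable_distFun μ).aemeasurable
        (measurableSet_eq_fun hc.measurable measurable_const)).symm
    exact ⟨fun H => ⟨hKF.1 H.apply_eq, hR.1 H.boundary, fun h0 => H.ne_zero (hz.2 h0)⟩,
      fun H => ⟨hKF.2 H.apply_eq, hR.2 H.boundary, fun h0 => H.ne_zero (hz.1 h0)⟩⟩
  exact ⟨fun H => (key (continuous_comp_distFun_iff.1 H.apply_eq.continuous)).1 H,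
    fun H => (key H.apply_eq.continuous).2 H⟩

theorem IsEigenfunction.comp_pseudoInv_comp_distFun [NullSingletonClass μ] {f : I → ℝ}
    {α β lam : ℝ} (hf : IsEigenfunction ν μ α β lam f) :
    (f ∘ pseudoInv μ) ∘ distFun μ = f :=
  funext fun x => hf.apply_eq.eq_of_distFun_eq (distFun_pseudoInv (distFun μ x))

/-! ### Transfer of orthonormal bases -/

/-- On the support of `μ`, a level interval of `F_μ` has no points besides its end points, as
`μ` does not charge its interior. -/
theorem eq_pseudoInv_or_eq_upperInv [NullSingletonClass μ] {x : I} (hx : x ∈ μ.support) :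
    x = pseudoInv μ (distFun μ x) ∨ x = upperInv μ (distFun μ x) := by
  by_contra! hne
  have h1 := (pseudoInv_le (μ := μ) (le_refl (distFun μ x))).lt_of_ne hne.1.symm
  have h2 := (le_upperInv (μ := μ) (le_refl (distFun μ x))).lt_of_ne hne.2
  refine ((Measure.mem_support_iff_forall x).1 hx _ (Ioo_mem_nhds h1 h2)).ne' ?_
  exact measure_Ioo_eq_zero_of_distFun_eq (by rw [distFun_pseudoInv, distFun_upperInv])

theorem exists_measurable_ae_leftInverse [NullSingletonClass μ] (hsupp : ν.support ⊆ μ.support)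
    (hatom : ∀ x y : I, ν {x} ≠ 0 → ν {y} ≠ 0 → distFun μ x = distFun μ y → x = y) :
    ∃ S : I → I, Measurable S ∧ ∀ᵐ x ∂ν, S (distFun μ x) = x := by
  classical
  set T : Set I := {t | pseudoInv μ t < upperInv μ t} with hT
  have hTc : T.Countable := countable_pseudoInv_lt_upperInv μ
  -- The upper end point is selected where it is an atom of `ν`, and the lower one elsewhere.
  set A : Set I := {t ∈ T | ν {upperInv μ t} ≠ 0} with hA
  have hAm : MeasurableSet A := (hTc.mono (sep_subset _ _)).measurableSet
  refine ⟨A.piecewise (upperInv μ) (pseudoInv μ),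
    (monotone_upperInv μ).measurable.piecewise hAm (monotone_pseudoInv μ).measurable, ?_⟩
  -- The selection can fail only at non-atoms among the end points of nondegenerate level sets.
  have hnull : ν {x ∈ pseudoInv μ '' T ∪ upperInv μ '' T | ν {x} = 0} = 0 := by
    have hc : {x ∈ pseudoInv μ '' T ∪ upperInv μ '' T | ν {x} = 0}.Countable :=
      ((hTc.image _).union (hTc.image _)).mono (sep_subset _ _)
    rw [← biUnion_of_singleton {x ∈ pseudoInv μ '' T ∪ upperInv μ '' T | ν {x} = 0}]
    exact (measure_biUnion_null_iff hc).2 fun x hx => hx.2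
  filter_upwards [compl_mem_ae_iff.2 hnull, Measure.support_mem_ae (μ := ν)] with x hx hxs
  set t := distFun μ x with ht
  have hends := eq_pseudoInv_or_eq_upperInv (hsupp hxs)
  rw [← ht] at hends
  by_cases htT : t ∈ T
  · have hxT : x ∈ pseudoInv μ '' T ∪ upperInv μ '' T :=
      hends.imp (fun h => ⟨t, htT, h.symm⟩) fun h => ⟨t, htT, h.symm⟩
    have hxatom : ν {x} ≠ 0 := fun h => hx ⟨hxT, h⟩
    by_cases htA : t ∈ A
    · rw [piecewise_eq_of_mem _ _ _ htA]
      exact hatom _ _ htA.2 hxatom (distFun_upperInv t)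
    · rw [piecewise_eq_of_notMem _ _ _ htA]
      refine (hends.resolve_right fun h => htA ⟨htT, ?_⟩).symm
      rwa [← h]
  · rw [piecewise_eq_of_notMem _ _ _ fun h => htT h.1]
    have hle : upperInv μ t ≤ pseudoInv μ t := not_lt.1 htT
    have h1 : pseudoInv μ t ≤ x := pseudoInv_le le_rfl
    have h2 : x ≤ upperInv μ t := le_upperInv le_rfl
    exact le_antisymm h1 (h2.trans hle)

/-- If `F` has a measurable left inverse off a `ν`-null set, then composition with `F` carries
orthonormal bases of `L²(ν ∘ F⁻¹)` to orthonormal bases of `L²(ν)`. -/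
theorem IsOrthonormalBasis.comp {ι : Type*} {F S : I → I} {f : ι → I → ℝ} (hF : Measurable F)
    (hS : Measurable S) (hSF : ∀ᵐ x ∂ν, S (F x) = x)
    (hf : IsOrthonormalBasis (ν.map F) f) : IsOrthonormalBasis ν fun i => f i ∘ F := by
  obtain ⟨B, hB⟩ := hf
  have hmp : MeasurePreserving F ν (ν.map F) := hF.measurePreserving ν
  let C : Lp ℝ 2 (ν.map F) →ₗᵢ[ℝ] Lp ℝ 2 ν := Lp.compMeasurePreservingₗᵢ ℝ F hmp
  have hC : ∀ u : Lp ℝ 2 (ν.map F), (C u : I → ℝ) =ᵐ[ν] u ∘ F := fun u =>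
    Lp.coeFn_compMeasurePreserving u hmp
  have hsurj : Function.Surjective C := fun v => by
    have hv := Lp.stronglyMeasurable v
    have hvS : (fun x => (v : I → ℝ) (S (F x))) =ᵐ[ν] v := by
      filter_upwards [hSF] with x hx
      rw [hx]
    have hmem : MemLp (fun t => (v : I → ℝ) (S t)) 2 (ν.map F) :=
      (memLp_map_measure_iff (hv.comp_measurable hS).aestronglyMeasurable hF.aemeasurable).2
        ((memLp_congr_ae hvS).2 (Lp.memLp v))
    refine ⟨hmem.toLp _, Lp.ext ?_⟩
    have hu : (hmem.toLp _ : I → ℝ) ∘ F =ᵐ[ν] fun x => (v : I → ℝ) (S (F x)) :=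
      ae_of_ae_map hF.aemeasurable hmem.coeFn_toLp
    exact (hC _).trans (hu.trans hvS)
  let e : Lp ℝ 2 (ν.map F) ≃ₗᵢ[ℝ] Lp ℝ 2 ν := LinearIsometryEquiv.ofSurjective C hsurj
  refine ⟨HilbertBasis.ofRepr (e.symm.trans B.repr), fun i => ?_⟩
  have hi : HilbertBasis.ofRepr (e.symm.trans B.repr) i = C (B i) := rfl
  rw [hi]
  exact (hC _).trans (ae_of_ae_map hF.aemeasurable (hB i))

end KreinFeller

theorem mainTheorem2 (μ ν : Measure I) [IsProbabilityMeasure μ] [IsProbabilityMeasure ν]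
    [NullSingletonClass μ] (hsupp : ν.support ⊆ μ.support) (hends : ν {0, 1} = 0)
    (α β : ℝ) (hα : α ∈ Icc 0 (Real.pi / 2)) (hβ : β ∈ Icc 0 (Real.pi / 2)) :
    -- the two operators have the same eigenvalues
    KreinFeller.eigenvalues (ν.map (KreinFeller.distFun μ)) (volume : Measure I) α β =
        KreinFeller.eigenvalues ν μ α β ∧
    -- the eigenfunctions correspond
    (∀ (lam : ℝ) (f : I → ℝ), KreinFeller.IsEigenfunction ν μ α β lam f →
      KreinFeller.IsEigenfunction (ν.map (KreinFeller.distFun μ)) (volume : Measure I) α β lam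
        (f ∘ KreinFeller.pseudoInv μ) ∧
      (f ∘ KreinFeller.pseudoInv μ) ∘ KreinFeller.distFun μ = f) ∧
    (∀ (lam : ℝ) (f : I → ℝ),
      KreinFeller.IsEigenfunction (ν.map (KreinFeller.distFun μ)) (volume : Measure I) α β lam f →
      KreinFeller.IsEigenfunction ν μ α β lam (f ∘ KreinFeller.distFun μ) ∧
      (f ∘ KreinFeller.distFun μ) ∘ KreinFeller.pseudoInv μ = f) ∧
    -- if the distribution function of `μ` separates the atoms of `ν`, then orthonormal bases of
    -- eigenfunctions are carried to orthonormal bases of eigenfunctions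
    ((∀ x y : I, ν {x} ≠ 0 → ν {y} ≠ 0 →
        KreinFeller.distFun μ x = KreinFeller.distFun μ y → x = y) →
      ∀ (ι : Type*) (lam : ι → ℝ) (f : ι → I → ℝ),
        (∀ i, KreinFeller.IsEigenfunction (ν.map (KreinFeller.distFun μ)) (volume : Measure I)
          α β (lam i) (f i)) →
        KreinFeller.IsOrthonormalBasis (ν.map (KreinFeller.distFun μ)) f →
        (∀ i, KreinFeller.IsEigenfunction ν μ α β (lam i) (f i ∘ KreinFeller.distFun μ)) ∧
        KreinFeller.IsOrthonormalBasis ν (fun i => f i ∘ KreinFeller.distFun μ)) := by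
  have h12 : ∀ (lam : ℝ) (f : I → ℝ), KreinFeller.IsEigenfunction ν μ α β lam f →
      KreinFeller.IsEigenfunction (ν.map (KreinFeller.distFun μ)) (volume : Measure I) α β lam
        (f ∘ KreinFeller.pseudoInv μ) ∧
      (f ∘ KreinFeller.pseudoInv μ) ∘ KreinFeller.distFun μ = f := fun lam f hf => by
    have hcomp := hf.comp_pseudoInv_comp_distFun
    refine ⟨KreinFeller.isEigenfunction_comp_iff.1 ?_, hcomp⟩
    rwa [hcomp]
  refine ⟨Set.ext fun lam => ⟨?_, ?_⟩, h12, fun lam f hf => ⟨?_, ?_⟩,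
    fun hatom ι lam f hf hB => ⟨fun i => ?_, ?_⟩⟩
  · rintro ⟨h, hh⟩
    exact ⟨_, KreinFeller.isEigenfunction_comp_iff.2 hh⟩
  · rintro ⟨f, hf⟩
    exact ⟨_, (h12 lam f hf).1⟩
  · exact KreinFeller.isEigenfunction_comp_iff.2 hf
  · exact funext fun t => congrArg f (KreinFeller.distFun_pseudoInv t)
  · exact KreinFeller.isEigenfunction_comp_iff.2 (hf i)
  · obtain ⟨S, hS, hSF⟩ := KreinFeller.exists_measurable_ae_leftInverse hsupp hatom
    exact hB.comp (KreinFeller.measurable_distFun μ) hS hSF
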